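/- Work in a nonstandard extension $X \mapsto {}^{*}X$ satisfying the transfer principle. Let $\Omega$ be an internal set. An internal probability space $(\Omega,\mathcal A,m)$ consists of an internal algebra $\mathcal A$ of internal subsets of $\Omega$ and an internal, (internally) finitely additive function $m:\mathcal A\to{}^{*}[0,1]$ with $m(\Omega)=1$; it is hyperfinite if $\mathcal A$ is a hyperfinite set ($\Omega$ itself need not be hyperfinite). Its Loeb extension is $(\Omega,\overline{\mathcal A},\overline m)$, where, with $\mathsf{st}$ the standard part map, $\overline{\mathcal A}$ is the collection of all (possibly external) sets $B\subseteq\Omega$ such that $$\sup\{\mathsf{st}(m(A)) : A\in\mathcal A,\ A\subseteq B\}=\inf\{\mathsf{st}(m(C)) : C\in\mathcal A,\ B\subseteq C\},$$ and $\overline m(B)$ is this common value. Two internal probability spaces $(\Omega,\mathcal A,m)$ and $(\Omega,\mathcal B,n)$ are Loeb equivalent if $\overline{\mathcal A}=\overline{\mathcal B}$ and $\overline m=\overline n$. **Theorem.** Let $\mathcal M=(\Omega,\mathcal F,\mu)$ and $\mathcal N=(\Omega,\mathcal G,\nu)$ be hyperfinite internal probability spaces that are Loeb equivalent to each other. Let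 $\mathcal H$ be the internal algebra on $\Omega$ generated by $\mathcal F\cup\mathcal G$. Then $\mathcal H$ is hyperfinite, and there is an internal probability measure $P$ on $\mathcal H$ such that $\mathcal M$ is Loeb equivalent to $(\Omega,\mathcal H,P)$. -/

import Mathlib

universe u v

/-- A nonstandard extension of the standard universe `Type u`: every standard set `X` has an
extension `*X`, every standard function `f` an extension `*f`, every `A ⊆ X` an extension
`*A ⊆ *X`, and the transfer principle holds. The transfer principle is expressed by its
clauses for atomic formulas, function symbols, connectives and quantifiers (the quantifier is the
image under a projection); induction on formulas gives transfer of every first-order statement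
about standard sets, relations and functions. No saturation is assumed, so all saturated
extensions are covered. -/
structure NonstandardExtension where
  /-- the extension `*X` of a standard set -/
  star : Type u → Type v
  /-- the canonical embedding `x ↦ *x` -/
  std {X : Type u} : X → star X
  /-- the extension `*f` of a standard function -/
  map {X Y : Type u} : (X → Y) → star X → star Y
  /-- the identification of `*X × *Y` with `*(X × Y)` -/
  pair {X Y : Type u} : star X → star Y → star (X × Y)
  /-- the extension `*A` of a standard subset `A ⊆ X` -/
  ext {X : Type u} : Set X → Set (star X)
  map_std {X Y : Type u} (f : X → Y) (x : X) : map f (std x) = std (f x)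
  map_id {X : Type u} (x : star X) : map id x = x
  map_comp {X Y Z : Type u} (g : Y → Z) (f : X → Y) (x : star X) :
    map (g ∘ f) x = map g (map f x)
  map_fst_pair {X Y : Type u} (x : star X) (y : star Y) : map Prod.fst (pair x y) = x
  map_snd_pair {X Y : Type u} (x : star X) (y : star Y) : map Prod.snd (pair x y) = y
  pair_map {X Y : Type u} (z : star (X × Y)) : pair (map Prod.fst z) (map Prod.snd z) = z
  /-- standard elements -/
  std_mem_ext {X : Type u} (A : Set X) (x : X) : std x ∈ ext A ↔ x ∈ A
  /-- equality -/
  ext_diag (X : Type u) :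
    ext {p : X × X | p.1 = p.2} = {z : star (X × X) | map Prod.fst z = map Prod.snd z}
  /-- substitution of functions -/
  ext_preimage {X Y : Type u} (f : X → Y) (B : Set Y) : ext (f ⁻¹' B) = map f ⁻¹' ext B
  /-- negation -/
  ext_compl {X : Type u} (A : Set X) : ext Aᶜ = (ext A)ᶜ
  /-- conjunction -/
  ext_inter {X : Type u} (A B : Set X) : ext (A ∩ B) = ext A ∩ ext B
  /-- existential quantification -/
  ext_image {X Y : Type u} (f : X → Y) (A : Set X) : ext (f '' A) = map f '' ext A

/-- The ultrapower by an arbitrary ultrafilter is a nonstandard extension. (Not used in the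
statement; it shows that the transfer clauses hold in the usual models.) -/
noncomputable def NonstandardExtension.ultrapower {I : Type v} (U : Ultrafilter I) : NonstandardExtension.{u, max u v} where
  star X := Filter.Germ (U : Filter I) X
  std x := (↑(fun _ : I => x) : Filter.Germ (U : Filter I) _)
  map f := Filter.Germ.map f
  pair x y := Filter.Germ.map₂ Prod.mk x y
  ext A := {z | Filter.Germ.LiftPred (· ∈ A) z}
  map_std f x := rfl
  map_id x := by simp
  map_comp g f x := by induction x using Filter.Germ.inductionOn; rfl
  map_fst_pair x y := by induction x, y using Filter.Germ.inductionOn₂; rfl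
  map_snd_pair x y := by induction x, y using Filter.Germ.inductionOn₂; rfl
  pair_map z := by induction z using Filter.Germ.inductionOn; rfl
  std_mem_ext A x := by simp [Filter.Germ.liftPred_coe]
  ext_diag X := by
    ext z; induction z using Filter.Germ.inductionOn
    simp [Filter.Germ.liftPred_coe, Filter.Germ.coe_eq]; rfl
  ext_preimage f B := by
    ext z; induction z using Filter.Germ.inductionOn
    simp [Filter.Germ.liftPred_coe]
  ext_compl A := by
    ext z; induction z using Filter.Germ.inductionOn
    exact Ultrafilter.eventually_not
  ext_inter A B := by
    ext z; induction z using Filter.Germ.inductionOn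
    simp [Filter.Germ.liftPred_coe]
  ext_image {X Y} f A := by
    ext z; induction z using Filter.Germ.inductionOn with | _ g
    constructor
    · intro h
      have h' : ∀ᶠ i in (U : Filter I), ∃ x, x ∈ A ∧ f x = g i := h
      classical
      obtain ⟨i0, x0, -⟩ := h'.exists
      refine ⟨(↑(fun i => if h : ∃ x, x ∈ A ∧ f x = g i then h.choose else x0) :
        Filter.Germ (U : Filter I) X), ?_, ?_⟩
      · show ∀ᶠ i in (U : Filter I), _ ∈ A
        filter_upwards [h'] with i hi
        rw [dif_pos hi]; exact hi.choose_spec.1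
      · show Filter.Germ.map f _ = _
        refine Filter.Germ.coe_eq.2 ?_
        filter_upwards [h'] with i hi
        simp only [Function.comp]
        rw [dif_pos hi]; exact hi.choose_spec.2
    · rintro ⟨z, hz, e⟩
      induction z using Filter.Germ.inductionOn with | _ k
      have e' : ∀ᶠ i in (U : Filter I), f (k i) = g i := Filter.Germ.coe_eq.1 e
      have hz' : ∀ᶠ i in (U : Filter I), k i ∈ A := hz
      exact (hz'.and e').mono fun i hi => ⟨_, hi.1, hi.2⟩

/-- `𝓐` is an algebra of subsets of `Ω`, where `Ω` is a subset of `X`. -/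
structure IsAlgebraOn {X : Type u} (Ω : Set X) (𝓐 : Set (Set X)) : Prop where
  subset : ∀ A ∈ 𝓐, A ⊆ Ω
  empty_mem : ∅ ∈ 𝓐
  diff_mem : ∀ A ∈ 𝓐, Ω \ A ∈ 𝓐
  union_mem : ∀ A ∈ 𝓐, ∀ B ∈ 𝓐, A ∪ B ∈ 𝓐

/-- The algebra of subsets of `Ω` generated by `𝓒`. -/
def generatedAlgebra {X : Type u} (Ω : Set X) (𝓒 : Set (Set X)) : Set (Set X) :=
  ⋂₀ {𝓐 | IsAlgebraOn Ω 𝓐 ∧ 𝓒 ⊆ 𝓐}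

/-- A standard finitely additive probability space `(Ω, 𝓐, m)` whose underlying set `Ω` is a
subset of `X`. The values of `m` outside `𝓐` play no role. -/
structure ProbSpaceIn (X : Type u) where
  /-- the underlying set `Ω` -/
  carrier : Set X
  /-- the algebra `𝓐` on `Ω` -/
  algebra : Set (Set X)
  /-- the probability measure `m` -/
  measure : Set X → ℝ
  isAlgebraOn : IsAlgebraOn carrier algebra
  measure_nonneg : ∀ A ∈ algebra, 0 ≤ measure A
  measure_carrier : measure carrier = 1
  measure_union : ∀ A ∈ algebra, ∀ B ∈ algebra, Disjoint A B →
    measure (A ∪ B) = measure A + measure B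

namespace NonstandardExtension

/-- The hyperreals `*ℝ`. -/
abbrev Hyper (S : NonstandardExtension.{u, v}) : Type v := S.star (ULift.{u} ℝ)

/-- The standard part of a finite hyperreal: the supremum of the reals `r` with `r ≤ x`. -/
noncomputable def st (S : NonstandardExtension.{u, v}) (x : S.Hyper) : ℝ :=
  sSup {r : ℝ | x ∈ S.ext {y : ULift.{u} ℝ | r ≤ y.down}}

/-- The internal membership relation `*∈` between `*X` and `*𝒫(X)`. -/
def Mem (S : NonstandardExtension.{u, v}) {X : Type u} (x : S.star X) (A : S.star (Set X)) :
    Prop :=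
  S.pair x A ∈ S.ext {p : X × Set X | p.1 ∈ p.2}

/-- The internal subset of `*X` given by `A ∈ *𝒫(X)`. -/
def toSet (S : NonstandardExtension.{u, v}) {X : Type u} (A : S.star (Set X)) :
    Set (S.star X) :=
  {x | S.Mem x A}

/-- An internal probability space `(Ω, 𝓐, m)`, with `Ω` an internal subset of `*X`: an element of
the extension of the set of all finitely additive probability spaces on subsets of `X`. -/
abbrev InternalProbSpace (S : NonstandardExtension.{u, v}) (X : Type u) : Type v :=
  S.star (ProbSpaceIn X)

variable (S : NonstandardExtension.{u, v}) {X : Type u}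

/-- The underlying internal set `Ω`, as an element of `*𝒫(X)`. -/
def carrier (M : S.InternalProbSpace X) : S.star (Set X) := S.map ProbSpaceIn.carrier M

/-- The internal algebra, as an element of `*𝒫(𝒫(X))`. -/
def algebra (M : S.InternalProbSpace X) : S.star (Set (Set X)) := S.map ProbSpaceIn.algebra M

/-- The internal measure of `A`, a hyperreal. -/
def measure (M : S.InternalProbSpace X) (A : S.star (Set X)) : S.Hyper :=
  S.map (fun p : ProbSpaceIn X × Set X => ULift.up (p.1.measure p.2)) (S.pair M A)

/-- The internal probability space is hyperfinite: its internal algebra is a hyperfinite set. -/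
def IsHyperfinite (M : S.InternalProbSpace X) : Prop :=
  S.algebra M ∈ S.ext {𝓐 : Set (Set X) | 𝓐.Finite}

/-- The internal algebra on the underlying set of `M` generated by the union of the algebras of
`M` and `N`. -/
def joinAlgebra (M N : S.InternalProbSpace X) : S.star (Set (Set X)) :=
  S.map (fun p : ProbSpaceIn X × ProbSpaceIn X =>
    generatedAlgebra p.1.carrier (p.1.algebra ∪ p.2.algebra)) (S.pair M N)

/-- Inner Loeb measure of an arbitrary (possibly external) set. -/
noncomputable def loebInner (M : S.InternalProbSpace X) (B : Set (S.star X)) : ℝ :=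
  sSup {r : ℝ | ∃ A, S.Mem A (S.algebra M) ∧ S.toSet A ⊆ B ∧ r = S.st (S.measure M A)}

/-- Outer Loeb measure of an arbitrary (possibly external) subset of the underlying set. -/
noncomputable def loebOuter (M : S.InternalProbSpace X) (B : Set (S.star X)) : ℝ :=
  sInf {r : ℝ | ∃ C, S.Mem C (S.algebra M) ∧ B ⊆ S.toSet C ∧ r = S.st (S.measure M C)}

/-- The Loeb algebra: the (possibly external) subsets `B` of the underlying set whose inner and
outer measures agree. -/
def loebAlgebra (M : S.InternalProbSpace X) : Set (Set (S.star X)) :=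
  {B | B ⊆ S.toSet (S.carrier M) ∧ S.loebInner M B = S.loebOuter M B}

/-- The Loeb measure; only its values on the Loeb algebra are meaningful. -/
noncomputable def loebMeasure (M : S.InternalProbSpace X) (B : Set (S.star X)) : ℝ :=
  S.loebInner M B

/-- Loeb equivalence of two internal probability spaces on the same internal set. -/
def LoebEquivalent (M N : S.InternalProbSpace X) : Prop :=
  S.carrier M = S.carrier N ∧ S.loebAlgebra M = S.loebAlgebra N ∧
    ∀ B ∈ S.loebAlgebra M, S.loebMeasure M B = S.loebMeasure N B

end NonstandardExtension

/-!
The key is a fact about finite algebras. Let `F` and `𝓖` be finite algebras on `Ω`, let `μ` be a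
finitely additive probability on `F`, and suppose that every `G ∈ 𝓖` lies between two sets of `F`
whose measures differ by at most `ε`. Then each `G` splits only atoms of `F` of total measure at
most `ε`. An atom split by one `G₀ ∈ 𝓖` is split by at least half of the sets in `𝓖`, because of
`G` and `G ∆ G₀` at least one separates the two points that `G₀` separates. Averaging over `𝓖`, the
atoms split by any set of `𝓖` at all have total measure at most `2 * ε`
(`ProbSpaceIn.measure_splitSet_le`). Let `Z` be their union. Off `Z`, every set `H` of the algebra
generated by `F ∪ 𝓖` is a union of atoms of `F`, so `H` lies between `H \ Z` and `H ∪ Z`, both in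
`F` (`ProbSpaceIn.approximates_generatedAlgebra`). Hence *any* extension of `μ` to the generated
algebra serves, and one is obtained by moving the mass of each atom of `F` to one of its points
(`ProbSpaceIn.exists_extension`).

Loeb equivalence makes every internal set of the algebra of `N` Loeb measurable for `M`, so the
hypothesis of the key fact holds for each standard `ε > 0`, and so by transfer does its conclusion.
The extension `Q` of `M` then assigns the same inner and outer Loeb measures as `M` to every subset of `Ω`
(`NonstandardExtension.loebEquivalent_of_approx`). Only standard `ε` occur, which is why no
saturation is needed.
-/

/-! ### Finite algebras of sets and their atoms -/

namespace IsAlgebraOn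

variable {X : Type u} {Ω : Set X} {𝓐 : Set (Set X)}

lemma carrier_mem (h : IsAlgebraOn Ω 𝓐) : Ω ∈ 𝓐 := by
  simpa using h.diff_mem ∅ h.empty_mem

lemma inter_mem (h : IsAlgebraOn Ω 𝓐) {A B : Set X} (hA : A ∈ 𝓐) (hB : B ∈ 𝓐) :
    A ∩ B ∈ 𝓐 := by
  have e : A ∩ B = Ω \ ((Ω \ A) ∪ (Ω \ B)) := by
    ext x
    have : x ∈ A → x ∈ Ω := fun hx => h.subset A hA hx
    simp only [Set.mem_inter_iff, Set.mem_sdiff, Set.mem_union]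
    tauto
  rw [e]
  exact h.diff_mem _ (h.union_mem _ (h.diff_mem _ hA) _ (h.diff_mem _ hB))

lemma sdiff_mem (h : IsAlgebraOn Ω 𝓐) {A B : Set X} (hA : A ∈ 𝓐) (hB : B ∈ 𝓐) :
    A \ B ∈ 𝓐 := by
  have e : A \ B = A ∩ (Ω \ B) := by
    ext x
    have : x ∈ A → x ∈ Ω := fun hx => h.subset A hA hx
    simp only [Set.mem_inter_iff, Set.mem_sdiff]
    tauto
  rw [e]
  exact h.inter_mem hA (h.diff_mem _ hB)

lemma symmDiff_mem (h : IsAlgebraOn Ω 𝓐) {A B : Set X} (hA : A ∈ 𝓐) (hB : B ∈ 𝓐) :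
    symmDiff A B ∈ 𝓐 :=
  h.union_mem _ (h.sdiff_mem hA hB) _ (h.sdiff_mem hB hA)

lemma sUnion_mem (h : IsAlgebraOn Ω 𝓐) {T : Set (Set X)} (hT : T.Finite) (hT𝓐 : T ⊆ 𝓐) :
    ⋃₀ T ∈ 𝓐 := by
  induction T, hT using Set.Finite.induction_on with
  | empty => simpa using h.empty_mem
  | insert _ _ ih =>
    rw [Set.sUnion_insert]
    exact h.union_mem _ (hT𝓐 (Set.mem_insert _ _)) _
      (ih ((Set.subset_insert _ _).trans hT𝓐))

end IsAlgebraOn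

/-- The atom of `x` in `𝓐`: the points of `Ω` that no set of `𝓐` separates from `x`. -/
def atomOf {X : Type u} (Ω : Set X) (𝓐 : Set (Set X)) (x : X) : Set X :=
  {y | y ∈ Ω ∧ ∀ A ∈ 𝓐, (x ∈ A ↔ y ∈ A)}

section Atoms

variable {X : Type u} {Ω : Set X} {𝓐 : Set (Set X)}

lemma mem_atomOf_self {x : X} (hx : x ∈ Ω) : x ∈ atomOf Ω 𝓐 x :=
  ⟨hx, fun _ _ => Iff.rfl⟩

lemma atomOf_eq {x y : X} (hy : y ∈ atomOf Ω 𝓐 x) : atomOf Ω 𝓐 y = atomOf Ω 𝓐 x := by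
  ext z
  exact and_congr_right fun _ => forall₂_congr fun A hA => by rw [hy.2 A hA]

lemma IsAlgebraOn.atomOf_mem (h : IsAlgebraOn Ω 𝓐) (hfin : 𝓐.Finite) (x : X) :
    atomOf Ω 𝓐 x ∈ 𝓐 := by
  have e : atomOf Ω 𝓐 x = Ω \ ⋃₀ {A ∈ 𝓐 | x ∉ A} := by
    ext y
    constructor
    · rintro ⟨hy, hxy⟩
      refine ⟨hy, ?_⟩
      rintro ⟨A, ⟨hA, hxA⟩, hyA⟩
      exact hxA ((hxy A hA).2 hyA)
    · rintro ⟨hy, hn⟩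
      refine ⟨hy, fun A hA => ⟨fun hxA => ?_, fun hyA => ?_⟩⟩
      · by_contra hyA
        exact hn ⟨Ω \ A, ⟨h.diff_mem A hA, fun hc => hc.2 hxA⟩, hy, hyA⟩
      · by_contra hxA
        exact hn ⟨A, ⟨hA, hxA⟩, hyA⟩
  rw [e]
  exact h.diff_mem _ (h.sUnion_mem (hfin.subset (Set.sep_subset _ _)) (Set.sep_subset _ _))

/-- A finite algebra contains every union of its atoms. -/
lemma IsAlgebraOn.mem_of_atomOf_subset (h : IsAlgebraOn Ω 𝓐) (hfin : 𝓐.Finite) {U : Set X}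
    (hU : U ⊆ Ω) (hsat : ∀ x ∈ U, atomOf Ω 𝓐 x ⊆ U) : U ∈ 𝓐 := by
  have e : U = ⋃₀ (atomOf Ω 𝓐 '' U) := by
    ext x
    constructor
    · exact fun hx => ⟨_, ⟨x, hx, rfl⟩, mem_atomOf_self (hU hx)⟩
    · rintro ⟨_, ⟨y, hy, rfl⟩, hxy⟩
      exact hsat y hy hxy
  have hsub : atomOf Ω 𝓐 '' U ⊆ 𝓐 := by
    rintro _ ⟨y, hy, rfl⟩
    exact h.atomOf_mem hfin y
  rw [e]
  exact h.sUnion_mem (hfin.subset hsub) hsub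

end Atoms

/-! ### The generated algebra -/

section Generated

variable {X : Type u} {Ω : Set X} {𝓒 : Set (Set X)}

lemma isAlgebraOn_powerset (Ω : Set X) : IsAlgebraOn Ω {A | A ⊆ Ω} where
  subset _ hA := hA
  empty_mem := Set.empty_subset _
  diff_mem _ _ := Set.sdiff_subset
  union_mem _ hA _ hB := Set.union_subset hA hB

lemma subset_generatedAlgebra : 𝓒 ⊆ generatedAlgebra Ω 𝓒 :=
  fun _ hC _ h𝓐 => h𝓐.2 hC

lemma isAlgebraOn_generatedAlgebra (h𝓒 : ∀ C ∈ 𝓒, C ⊆ Ω) :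
    IsAlgebraOn Ω (generatedAlgebra Ω 𝓒) where
  subset _ hA := hA _ ⟨isAlgebraOn_powerset Ω, h𝓒⟩
  empty_mem _ h𝓐 := h𝓐.1.empty_mem
  diff_mem A hA 𝓐 h𝓐 := h𝓐.1.diff_mem A (hA 𝓐 h𝓐)
  union_mem A hA B hB 𝓐 h𝓐 := h𝓐.1.union_mem A (hA 𝓐 h𝓐) B (hB 𝓐 h𝓐)

/-- A set of the generated algebra does not separate two points that no generator separates. -/
lemma mem_of_mem_generatedAlgebra (h𝓒 : ∀ C ∈ 𝓒, C ⊆ Ω) {H : Set X}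
    (hH : H ∈ generatedAlgebra Ω 𝓒) {x y : X} (hy : y ∈ atomOf Ω 𝓒 x) (hx : x ∈ H) : y ∈ H := by
  have hxΩ : x ∈ Ω := (isAlgebraOn_generatedAlgebra h𝓒).subset H hH hx
  have halg : IsAlgebraOn Ω {A | A ⊆ Ω ∧ (x ∈ A ↔ y ∈ A)} :=
    { subset := fun A hA => hA.1
      empty_mem := ⟨Set.empty_subset _, by simp⟩
      diff_mem := fun A hA => ⟨Set.sdiff_subset, by simp [hxΩ, hy.1, hA.2]⟩
      union_mem := fun A hA B hB =>
        ⟨Set.union_subset hA.1 hB.1, by simp [hA.2, hB.2]⟩ }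
  exact (hH _ ⟨halg, fun C hC => ⟨h𝓒 C hC, hy.2 C hC⟩⟩).2.1 hx

lemma generatedAlgebra_finite (h𝓒 : ∀ C ∈ 𝓒, C ⊆ Ω) (hfin : 𝓒.Finite) :
    (generatedAlgebra Ω 𝓒).Finite := by
  -- A set of the generated algebra is determined by the subfamilies `{C ∈ 𝓒 | x ∈ C}` of its points.
  refine (hfin.powerset.powerset.image
    fun T : Set (Set (Set X)) => {x | x ∈ Ω ∧ {C ∈ 𝓒 | x ∈ C} ∈ T}).subset fun H hH => ?_
  refine ⟨(fun x => {C ∈ 𝓒 | x ∈ C}) '' H, ?_, ?_⟩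
  · rintro _ ⟨x, -, rfl⟩
    exact Set.sep_subset _ _
  · ext y
    constructor
    · rintro ⟨hy, x, hx, e⟩
      refine mem_of_mem_generatedAlgebra h𝓒 hH ⟨hy, fun C hC => ?_⟩ hx
      have := Set.ext_iff.1 e C
      simpa [hC] using this
    · exact fun hy => ⟨(isAlgebraOn_generatedAlgebra h𝓒).subset H hH hy, y, hy, rfl⟩

end Generated

/-! ### Finitely additive probabilities on finite algebras -/

namespace ProbSpaceIn

variable {X : Type u} (p : ProbSpaceIn X)

lemma measure_empty : p.measure ∅ = 0 := by
  have := p.measure_union ∅ p.isAlgebraOn.empty_mem ∅ p.isAlgebraOn.empty_mem (by simp)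
  rw [Set.empty_union] at this
  linarith

lemma measure_sdiff {A C : Set X} (hA : A ∈ p.algebra) (hC : C ∈ p.algebra) (hAC : A ⊆ C) :
    p.measure (C \ A) = p.measure C - p.measure A := by
  have := p.measure_union A hA (C \ A) (p.isAlgebraOn.sdiff_mem hC hA) Set.disjoint_sdiff_right
  rw [Set.union_sdiff_cancel hAC] at this
  linarith

lemma measure_mono {A C : Set X} (hA : A ∈ p.algebra) (hC : C ∈ p.algebra) (hAC : A ⊆ C) :
    p.measure A ≤ p.measure C := by
  have := p.measure_nonneg _ (p.isAlgebraOn.sdiff_mem hC hA)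
  rw [p.measure_sdiff hA hC hAC] at this
  linarith

lemma measure_le_one {A : Set X} (hA : A ∈ p.algebra) : p.measure A ≤ 1 :=
  (p.measure_mono hA p.isAlgebraOn.carrier_mem (p.isAlgebraOn.subset A hA)).trans_eq
    p.measure_carrier

lemma measure_sUnion (T : Finset (Set X)) (hT : ∀ A ∈ T, A ∈ p.algebra)
    (hdisj : (T : Set (Set X)).PairwiseDisjoint id) :
    p.measure (⋃₀ (T : Set (Set X))) = ∑ A ∈ T, p.measure A := by
  classical
  induction T using Finset.induction_on with
  | empty => simpa using p.measure_empty
  | insert A T hAT ih =>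
    rw [Finset.coe_insert] at hdisj ⊢
    rw [Set.sUnion_insert, Finset.sum_insert hAT,
      ← ih (fun B hB => hT B (Finset.mem_insert_of_mem hB))
        (hdisj.subset (Set.subset_insert _ _))]
    refine p.measure_union _ (hT A (Finset.mem_insert_self _ _)) _
      (p.isAlgebraOn.sUnion_mem T.finite_toSet
        fun B hB => hT B (Finset.mem_insert_of_mem hB)) ?_
    rw [Set.disjoint_sUnion_right]
    intro B hB
    refine hdisj (Set.mem_insert _ _) (Set.mem_insert_of_mem _ hB) ?_
    rintro rfl
    exact hAT hB

variable {p}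

/-- On a finite algebra, the measure of a set is the sum of the measures of its atoms. -/
lemma measure_eq_sum_atomOf {𝓢 : Finset (Set X)} (hfin : p.algebra.Finite)
    (h𝓢 : ∀ a, a ∈ 𝓢 ↔ ∃ x ∈ p.carrier, a = atomOf p.carrier p.algebra x)
    {U : Set X} (hU : U ∈ p.algebra) [DecidablePred fun a : Set X => a ⊆ U] :
    p.measure U = ∑ a ∈ 𝓢 with a ⊆ U, p.measure a := by
  rw [← p.measure_sUnion]
  · congr 1
    ext x
    constructor
    · intro hx
      have hxΩ := p.isAlgebraOn.subset U hU hx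
      refine ⟨atomOf p.carrier p.algebra x, ?_, mem_atomOf_self hxΩ⟩
      exact Finset.mem_coe.2 (Finset.mem_filter.2
        ⟨(h𝓢 _).2 ⟨x, hxΩ, rfl⟩, fun y hy => (hy.2 U hU).1 hx⟩)
    · rintro ⟨a, ha, hxa⟩
      exact (Finset.mem_filter.1 (Finset.mem_coe.1 ha)).2 hxa
  · intro a ha
    obtain ⟨x, -, rfl⟩ := (h𝓢 a).1 (Finset.mem_filter.1 ha).1
    exact p.isAlgebraOn.atomOf_mem hfin x
  · intro a ha b hb hab
    obtain ⟨x, hx, rfl⟩ := (h𝓢 a).1 (Finset.mem_filter.1 (Finset.mem_coe.1 ha)).1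
    obtain ⟨y, hy, rfl⟩ := (h𝓢 b).1 (Finset.mem_filter.1 (Finset.mem_coe.1 hb)).1
    refine Set.disjoint_left.2 fun z hzx hzy => hab ?_
    exact (atomOf_eq hzx).symm.trans (atomOf_eq hzy)

variable (p)

/-- A finitely additive probability on a finite algebra extends to all sets, and so to any other
algebra `𝓗`: move the mass of each atom to one of its points. -/
lemma exists_extension (hfin : p.algebra.Finite) {𝓗 : Set (Set X)}
    (h𝓗 : IsAlgebraOn p.carrier 𝓗) :
    ∃ q : ProbSpaceIn X, q.carrier = p.carrier ∧ q.algebra = 𝓗 ∧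
      ∀ A ∈ p.algebra, q.measure A = p.measure A := by
  classical
  -- `c x` depends only on the atom of `x`.
  let c : X → X := fun x =>
    if h : (atomOf p.carrier p.algebra x).Nonempty then h.some else x
  have hc : ∀ x ∈ p.carrier, c x ∈ atomOf p.carrier p.algebra x := by
    intro x hx
    have h : (atomOf p.carrier p.algebra x).Nonempty := ⟨x, mem_atomOf_self hx⟩
    simp only [c, dif_pos h]
    exact h.some_mem
  have hceq : ∀ x ∈ p.carrier, ∀ y ∈ atomOf p.carrier p.algebra x, c y = c x := by
    intro x hx y hy
    have h : (atomOf p.carrier p.algebra x).Nonempty := ⟨y, hy⟩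
    simp only [c, atomOf_eq hy, dif_pos h]
  have hmem : ∀ H : Set X, p.carrier ∩ c ⁻¹' H ∈ p.algebra := by
    intro H
    refine p.isAlgebraOn.mem_of_atomOf_subset hfin Set.inter_subset_left ?_
    rintro x ⟨hx, hxH⟩ y hy
    refine ⟨hy.1, ?_⟩
    rw [Set.mem_preimage, hceq x hx y hy]
    exact hxH
  have hext : ∀ A ∈ p.algebra, p.carrier ∩ c ⁻¹' A = A := by
    intro A hA
    ext x
    constructor
    · rintro ⟨hx, hxA⟩
      exact ((hc x hx).2 A hA).2 hxA
    · intro hxA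
      have hx := p.isAlgebraOn.subset A hA hxA
      exact ⟨hx, ((hc x hx).2 A hA).1 hxA⟩
  refine ⟨{ carrier := p.carrier
            algebra := 𝓗
            measure := fun H => p.measure (p.carrier ∩ c ⁻¹' H)
            isAlgebraOn := h𝓗
            measure_nonneg := fun H _ => p.measure_nonneg _ (hmem H)
            measure_carrier := ?_
            measure_union := fun A _ B _ hAB => ?_ }, rfl, rfl, fun A hA => ?_⟩
  · rw [hext _ p.isAlgebraOn.carrier_mem, p.measure_carrier]
  · rw [Set.preimage_union, Set.inter_union_distrib_left]
    exact p.measure_union _ (hmem A) _ (hmem B)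
      ((hAB.preimage c).mono Set.inter_subset_right Set.inter_subset_right)
  · exact congrArg p.measure (hext A hA)

/-- Every set of the family `𝓖` lies between two sets of the algebra whose measures differ by at
most `ε`. -/
def Approximates (ε : ℝ) (𝓖 : Set (Set X)) : Prop :=
  ∀ G, G ∈ 𝓖 → ∃ A, ∃ C, A ∈ p.algebra ∧ C ∈ p.algebra ∧ A ⊆ G ∧ G ⊆ C ∧
    p.measure C ≤ p.measure A + ε

/-- The union of the atoms of `p` that are split by some set of `𝓖`. -/
def splitSet (𝓖 : Set (Set X)) : Set X :=
  {x | x ∈ p.carrier ∧ ∃ G ∈ 𝓖, ∃ y ∈ atomOf p.carrier p.algebra x,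
    ∃ z ∈ atomOf p.carrier p.algebra x, y ∈ G ∧ z ∉ G}

lemma splitSet_mem (hfin : p.algebra.Finite) (𝓖 : Set (Set X)) :
    p.splitSet 𝓖 ∈ p.algebra := by
  refine p.isAlgebraOn.mem_of_atomOf_subset hfin (fun x hx => hx.1) ?_
  rintro x ⟨-, h⟩ y hy
  refine ⟨hy.1, ?_⟩
  rwa [atomOf_eq hy]

/-- Each `G ∈ 𝓖` splits only atoms inside `C \ A`, where `A ⊆ G ⊆ C` is its approximation, so atoms
of total measure at most `ε`. An atom split by any set of `𝓖` is split by at least half of them, so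
the bound `2 * ε` follows by averaging over `𝓖`. -/
lemma measure_splitSet_le (hfin : p.algebra.Finite) {𝓖 : Set (Set X)}
    (h𝓖 : IsAlgebraOn p.carrier 𝓖) (h𝓖fin : 𝓖.Finite) {ε : ℝ} (happ : p.Approximates ε 𝓖) :
    p.measure (p.splitSet 𝓖) ≤ 2 * ε := by
  classical
  let 𝓢 : Finset (Set X) :=
    hfin.toFinset.filter fun a => ∃ x ∈ p.carrier, a = atomOf p.carrier p.algebra x
  have h𝓢 : ∀ a, a ∈ 𝓢 ↔ ∃ x ∈ p.carrier, a = atomOf p.carrier p.algebra x := by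
    intro a
    simp only [𝓢, Finset.mem_filter, Set.Finite.mem_toFinset, and_iff_right_iff_imp]
    rintro ⟨x, -, rfl⟩
    exact p.isAlgebraOn.atomOf_mem hfin x
  have h𝓢nonneg : ∀ a ∈ 𝓢, 0 ≤ p.measure a := fun a ha =>
    p.measure_nonneg a (hfin.mem_toFinset.1 (Finset.mem_filter.1 ha).1)
  let 𝓚 : Finset (Set X) := h𝓖fin.toFinset
  let Splits : Set X → Set X → Prop := fun G a => (∃ y ∈ a, y ∈ G) ∧ ∃ z ∈ a, z ∉ G
  let 𝓑 : Finset (Set X) := 𝓢.filter fun a => a ⊆ p.splitSet 𝓖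
  have hbound : ∀ G ∈ 𝓚, ∑ a ∈ 𝓑, (if Splits G a then p.measure a else 0) ≤ ε := by
    intro G hG
    obtain ⟨A, C, hA, hC, hAG, hGC, hAC⟩ := happ G (h𝓖fin.mem_toFinset.1 hG)
    have hCA := p.isAlgebraOn.sdiff_mem hC hA
    have hval := p.measure_sdiff hA hC (hAG.trans hGC)
    rw [measure_eq_sum_atomOf hfin h𝓢 hCA] at hval
    rw [← Finset.sum_filter]
    refine (Finset.sum_le_sum_of_subset_of_nonneg ?_ ?_).trans
      (hval.trans_le (by linarith))
    · intro a ha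
      obtain ⟨ha, ⟨y, hya, hyG⟩, z, hza, hzG⟩ := Finset.mem_filter.1 ha
      have ha𝓢 := (Finset.mem_filter.1 ha).1
      obtain ⟨x, hx, rfl⟩ := (h𝓢 a).1 ha𝓢
      refine Finset.mem_filter.2 ⟨ha𝓢, fun w hw => ⟨?_, fun hwA => ?_⟩⟩
      · exact (hw.2 C hC).1 ((hya.2 C hC).2 (hGC hyG))
      · exact hzG (hAG ((hza.2 A hA).1 ((hw.2 A hA).2 hwA)))
    · exact fun a ha _ => h𝓢nonneg a (Finset.mem_filter.1 ha).1
  have hhalf : ∀ a ∈ 𝓑, (𝓚.card : ℝ) ≤ 2 * (𝓚.filter fun G => Splits G a).card := by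
    intro a ha
    obtain ⟨ha𝓢, haZ⟩ := Finset.mem_filter.1 ha
    obtain ⟨x, hx, rfl⟩ := (h𝓢 a).1 ha𝓢
    obtain ⟨-, G₀, hG₀, y, hy, z, hz, hyG, hzG⟩ := haZ (mem_atomOf_self hx)
    -- The involution `G ↦ G ∆ G₀` changes the side of `y` but not that of `z`.
    have hle : (𝓚.filter fun G => ¬ Splits G (atomOf p.carrier p.algebra x)).card ≤
        (𝓚.filter fun G => Splits G (atomOf p.carrier p.algebra x)).card := by
      refine Finset.card_le_card_of_injOn (fun G => symmDiff G G₀) ?_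
        ((symmDiff_left_injective G₀).injOn)
      intro G hG
      obtain ⟨hG, hns⟩ := Finset.mem_filter.1 (Finset.mem_coe.1 hG)
      refine Finset.mem_coe.2 (Finset.mem_filter.2 ⟨h𝓖fin.mem_toFinset.2
        (h𝓖.symmDiff_mem (h𝓖fin.mem_toFinset.1 hG) hG₀), ?_⟩)
      by_cases hyG' : y ∈ G
      · have hzG' : z ∈ G := by
          by_contra hzG'
          exact hns ⟨⟨y, hy, hyG'⟩, z, hz, hzG'⟩
        exact ⟨⟨z, hz, Or.inl ⟨hzG', hzG⟩⟩, y, hy, by simp [Set.mem_symmDiff, hyG, hyG']⟩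
      · have hzG' : z ∉ G := fun hzG' => hns ⟨⟨z, hz, hzG'⟩, y, hy, hyG'⟩
        exact ⟨⟨y, hy, Or.inr ⟨hyG, hyG'⟩⟩, z, hz, by simp [Set.mem_symmDiff, hzG, hzG']⟩
    have hsum := Finset.card_filter_add_card_filter_not (s := 𝓚)
      fun G => Splits G (atomOf p.carrier p.algebra x)
    exact_mod_cast (by omega : 𝓚.card ≤
      2 * (𝓚.filter fun G => Splits G (atomOf p.carrier p.algebra x)).card)
  have hpos : (0 : ℝ) < 𝓚.card :=
    Nat.cast_pos.2 (Finset.card_pos.2 ⟨∅, h𝓖fin.mem_toFinset.2 h𝓖.empty_mem⟩)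
  have hkey : (𝓚.card : ℝ) * p.measure (p.splitSet 𝓖) ≤ 𝓚.card * (2 * ε) := by
    calc (𝓚.card : ℝ) * p.measure (p.splitSet 𝓖)
        = ∑ a ∈ 𝓑, (𝓚.card : ℝ) * p.measure a := by
          rw [measure_eq_sum_atomOf hfin h𝓢 (p.splitSet_mem hfin 𝓖), Finset.mul_sum]
      _ ≤ ∑ a ∈ 𝓑, 2 * ∑ G ∈ 𝓚, (if Splits G a then p.measure a else 0) := by
          refine Finset.sum_le_sum fun a ha => ?_
          rw [← Finset.sum_filter, Finset.sum_const, nsmul_eq_mul, ← mul_assoc]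
          exact mul_le_mul_of_nonneg_right (hhalf a ha)
            (h𝓢nonneg a (Finset.mem_filter.1 ha).1)
      _ = 2 * ∑ G ∈ 𝓚, ∑ a ∈ 𝓑, (if Splits G a then p.measure a else 0) := by
          rw [← Finset.mul_sum, Finset.sum_comm]
      _ ≤ 2 * ∑ _G ∈ 𝓚, ε := by gcongr with G hG; exact hbound G hG
      _ = 𝓚.card * (2 * ε) := by rw [Finset.sum_const, nsmul_eq_mul]; ring
  exact le_of_mul_le_mul_left hkey hpos

/-- Outside the split set, every set of the algebra generated by `p.algebra ∪ 𝓖` is a union of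
atoms of `p`; so approximation passes from `𝓖` to the generated algebra. -/
lemma approximates_generatedAlgebra (hfin : p.algebra.Finite) {𝓖 : Set (Set X)}
    (h𝓖 : IsAlgebraOn p.carrier 𝓖) (h𝓖fin : 𝓖.Finite) {ε : ℝ} (happ : p.Approximates ε 𝓖) :
    p.Approximates (2 * ε) (generatedAlgebra p.carrier (p.algebra ∪ 𝓖)) := by
  intro H hH
  set Z := p.splitSet 𝓖
  have hZmem : Z ∈ p.algebra := p.splitSet_mem hfin 𝓖
  have hsub : ∀ C ∈ p.algebra ∪ 𝓖, C ⊆ p.carrier := fun C hC =>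
    hC.elim (p.isAlgebraOn.subset C) (h𝓖.subset C)
  have hHΩ : H ⊆ p.carrier := (isAlgebraOn_generatedAlgebra hsub).subset H hH
  have hdiff : H \ Z ∈ p.algebra := by
    refine p.isAlgebraOn.mem_of_atomOf_subset hfin (Set.sdiff_subset.trans hHΩ) ?_
    rintro x ⟨hxH, hxZ⟩ y hy
    have hx := hHΩ hxH
    refine ⟨mem_of_mem_generatedAlgebra hsub hH ⟨hy.1, ?_⟩ hxH,
      fun hyZ => hxZ ((hy.2 Z hZmem).2 hyZ)⟩
    rintro C (hC | hC)
    · exact hy.2 C hC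
    · constructor
      · intro hxC
        by_contra hyC
        exact hxZ ⟨hx, C, hC, x, mem_atomOf_self hx, y, hy, hxC, hyC⟩
      · intro hyC
        by_contra hxC
        exact hxZ ⟨hx, C, hC, y, hy, x, mem_atomOf_self hx, hyC, hxC⟩
  refine ⟨H \ Z, (H \ Z) ∪ Z, hdiff, p.isAlgebraOn.union_mem _ hdiff _ hZmem,
    Set.sdiff_subset, by rw [Set.sdiff_union_self]; exact Set.subset_union_left, ?_⟩
  rw [p.measure_union _ hdiff _ hZmem Set.disjoint_sdiff_left]
  have := p.measure_splitSet_le hfin h𝓖 h𝓖fin happ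
  linarith

end ProbSpaceIn

/-! ### The transfer principle -/

namespace NonstandardExtension

variable (S : NonstandardExtension.{u, v}) {W X Y Z : Type u}

lemma ext_univ : S.ext (Set.univ : Set X) = Set.univ := by
  have h : S.ext (∅ : Set X) = ∅ := by
    rw [← Set.inter_compl_self (∅ : Set X), S.ext_inter, S.ext_compl, Set.inter_compl_self]
  rw [← Set.compl_empty, S.ext_compl, h, Set.compl_empty]

lemma mem_ext_of_forall {R : X → Prop} (h : ∀ x, R x) (z : S.star X) : z ∈ S.ext {x | R x} := by
  have e : {x | R x} = Set.univ := Set.eq_univ_of_forall h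
  rw [e, S.ext_univ]
  trivial

lemma ext_mono {A B : Set X} (h : A ⊆ B) : S.ext A ⊆ S.ext B := by
  rw [← Set.inter_eq_left.2 h, S.ext_inter]
  exact Set.inter_subset_right

lemma mem_ext_and {R T : X → Prop} (z : S.star X) :
    z ∈ S.ext {x | R x ∧ T x} ↔ z ∈ S.ext {x | R x} ∧ z ∈ S.ext {x | T x} := by
  rw [Set.ofPred_and, S.ext_inter, Set.mem_inter_iff]

lemma mem_ext_not {R : X → Prop} (z : S.star X) :
    z ∈ S.ext {x | ¬ R x} ↔ z ∉ S.ext {x | R x} := by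
  rw [← Set.compl_ofPred, S.ext_compl, Set.mem_compl_iff]

lemma mem_ext_imp {R T : X → Prop} (z : S.star X) :
    z ∈ S.ext {x | R x → T x} ↔ (z ∈ S.ext {x | R x} → z ∈ S.ext {x | T x}) := by
  have e : {x | R x → T x} = {x | ¬ (R x ∧ ¬ T x)} := by ext x; simp
  rw [e, mem_ext_not, mem_ext_and, mem_ext_not]
  tauto

lemma mem_ext_map (f : X → Y) (R : Y → Prop) (z : S.star X) :
    S.map f z ∈ S.ext {y | R y} ↔ z ∈ S.ext {x | R (f x)} := by
  rw [← Set.mem_preimage, ← S.ext_preimage]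
  rfl

lemma mem_ext_exists {R : X → Y → Prop} (z : S.star X) :
    z ∈ S.ext {x | ∃ y, R x y} ↔
      ∃ y : S.star Y, S.pair z y ∈ S.ext {p : X × Y | R p.1 p.2} := by
  have e : {x | ∃ y, R x y} = Prod.fst '' {p : X × Y | R p.1 p.2} := by ext x; simp
  rw [e, S.ext_image]
  constructor
  · rintro ⟨p, hp, rfl⟩
    exact ⟨S.map Prod.snd p, by rwa [S.pair_map]⟩
  · rintro ⟨y, hy⟩
    exact ⟨_, hy, S.map_fst_pair z y⟩

lemma mem_ext_forall {R : X → Y → Prop} (z : S.star X) :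
    z ∈ S.ext {x | ∀ y, R x y} ↔
      ∀ y : S.star Y, S.pair z y ∈ S.ext {p : X × Y | R p.1 p.2} := by
  have e : {x | ∀ y, R x y} = {x | ¬ ∃ y, ¬ R x y} := by ext x; simp
  rw [e, mem_ext_not, mem_ext_exists, not_exists]
  simp only [mem_ext_not, not_not]

lemma map_prodMk (f : W → X) (g : W → Y) (z : S.star W) :
    S.map (fun w => (f w, g w)) z = S.pair (S.map f z) (S.map g z) := by
  rw [← S.pair_map (S.map (fun w => (f w, g w)) z), ← S.map_comp, ← S.map_comp]
  rfl

lemma map_map (g : Y → Z) (f : X → Y) (z : S.star X) :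
    S.map g (S.map f z) = S.map (fun x => g (f x)) z :=
  (S.map_comp g f z).symm

lemma map_eq_map_iff (f g : X → Y) (z : S.star X) :
    S.map f z = S.map g z ↔ z ∈ S.ext {x | f x = g x} := by
  have h := S.mem_ext_map (fun x => (f x, g x)) (fun p => p.1 = p.2) z
  rw [← h, S.ext_diag, Set.mem_ofPred_eq, map_map, map_map]

lemma mem_map_map (f : W → X) (g : W → Set X) (z : S.star W) :
    S.Mem (S.map f z) (S.map g z) ↔ z ∈ S.ext {w | f w ∈ g w} := by
  rw [Mem, ← map_prodMk]
  exact S.mem_ext_map (fun w => (f w, g w)) (fun p => p.1 ∈ p.2) z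

lemma toSet_map_subset (f g : W → Set X) (z : S.star W) :
    S.toSet (S.map f z) ⊆ S.toSet (S.map g z) ↔ z ∈ S.ext {w | f w ⊆ g w} := by
  have e : {w | f w ⊆ g w} = {w | ∀ x, x ∈ f w → x ∈ g w} := rfl
  rw [e, mem_ext_forall]
  refine forall_congr' fun x => ?_
  rw [mem_ext_imp, ← mem_map_map, ← mem_map_map, S.map_snd_pair,
    ← S.map_map f Prod.fst, ← S.map_map g Prod.fst, S.map_fst_pair]
  rfl

/-! ### Hyperreals and standard parts -/

/-- The real `r` is at most the hyperreal `x`. -/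
def RealLE (r : ℝ) (x : S.Hyper) : Prop := x ∈ S.ext {y : ULift.{u} ℝ | r ≤ y.down}

/-- `x ≤ y + ε` for hyperreals `x`, `y` and a real `ε`. -/
def LEAdd (ε : ℝ) (x y : S.Hyper) : Prop :=
  S.pair x y ∈ S.ext {p : ULift.{u} ℝ × ULift.{u} ℝ | p.1.down ≤ p.2.down + ε}

variable {S}

lemma pair_mem_ext_fst {R : X → Prop} {x : S.star X} {y : S.star Y} :
    S.pair x y ∈ S.ext {p : X × Y | R p.1} ↔ x ∈ S.ext {x | R x} := by
  rw [← S.mem_ext_map Prod.fst, S.map_fst_pair]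

lemma pair_mem_ext_snd {R : Y → Prop} {x : S.star X} {y : S.star Y} :
    S.pair x y ∈ S.ext {p : X × Y | R p.2} ↔ y ∈ S.ext {y | R y} := by
  rw [← S.mem_ext_map Prod.snd, S.map_snd_pair]

lemma RealLE.of_leAdd {r ε : ℝ} {x y : S.Hyper} (hr : S.RealLE r x) (h : S.LEAdd ε x y) :
    S.RealLE (r - ε) y := by
  have h1 : S.pair x y ∈ S.ext {p : ULift.{u} ℝ × ULift.{u} ℝ |
      r ≤ p.1.down ∧ p.1.down ≤ p.2.down + ε} :=
    (S.mem_ext_and (R := fun p : ULift.{u} ℝ × ULift.{u} ℝ => r ≤ p.1.down) _).2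
      ⟨pair_mem_ext_fst.2 hr, h⟩
  exact pair_mem_ext_snd.1 (S.ext_mono (B := {p | r - ε ≤ p.2.down})
    (fun p hp => by have := hp.1; have := hp.2; simp only [Set.mem_ofPred_eq]; linarith) h1)

lemma leAdd_of_realLE {r s ε : ℝ} {x y : S.Hyper} (hε : s - r ≤ ε) (hx : ¬ S.RealLE s x)
    (hy : S.RealLE r y) : S.LEAdd ε x y := by
  have h1 : S.pair x y ∈ S.ext {p : ULift.{u} ℝ × ULift.{u} ℝ |
      ¬ s ≤ p.1.down ∧ r ≤ p.2.down} :=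
    (S.mem_ext_and (R := fun p : ULift.{u} ℝ × ULift.{u} ℝ => ¬ s ≤ p.1.down) _).2
      ⟨(S.mem_ext_not _).2 fun h => hx (pair_mem_ext_fst.1 h), pair_mem_ext_snd.2 hy⟩
  exact S.ext_mono
    (fun p hp => by have := hp.1; have := hp.2; simp only [Set.mem_ofPred_eq]; linarith) h1

lemma RealLE.mono {r s : ℝ} {x : S.Hyper} (h : S.RealLE s x) (hrs : r ≤ s) : S.RealLE r x :=
  S.ext_mono (fun _ hy => hrs.trans hy) h

/-- `x` lies in `*[0, 1]`. -/
def InUnit (x : S.Hyper) : Prop := x ∈ S.ext {y : ULift.{u} ℝ | 0 ≤ y.down ∧ y.down ≤ 1}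

lemma InUnit.zero_le {x : S.Hyper} (hx : InUnit x) : S.RealLE 0 x :=
  S.ext_mono (fun _ hy => hy.1) hx

lemma InUnit.realLE_le_one {x : S.Hyper} (hx : InUnit x) {r : ℝ} (hr : S.RealLE r x) :
    r ≤ 1 := by
  have h : x ∈ S.ext {_y : ULift.{u} ℝ | r ≤ 1} := by
    refine S.ext_mono ?_ ((S.mem_ext_and _).2 ⟨hx, hr⟩)
    exact fun y hy => le_trans hy.2 hy.1.2
  by_contra hn
  exact (S.mem_ext_not x).1 (S.mem_ext_of_forall (R := fun _ => ¬ r ≤ 1) (fun _ => hn) x) h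

lemma InUnit.le_st {x : S.Hyper} (hx : InUnit x) {r : ℝ} (hr : S.RealLE r x) : r ≤ S.st x :=
  le_csSup ⟨1, fun _ hs => hx.realLE_le_one hs⟩ hr

lemma InUnit.st_nonneg {x : S.Hyper} (hx : InUnit x) : 0 ≤ S.st x :=
  hx.le_st hx.zero_le

lemma InUnit.st_le_one {x : S.Hyper} (hx : InUnit x) : S.st x ≤ 1 :=
  csSup_le ⟨0, hx.zero_le⟩ fun _ hs => hx.realLE_le_one hs

lemma InUnit.realLE_of_lt_st {x : S.Hyper} (hx : InUnit x) {r : ℝ} (hr : r < S.st x) :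
    S.RealLE r x := by
  obtain ⟨s, hs, hrs⟩ := exists_lt_of_lt_csSup ⟨0, hx.zero_le⟩ hr
  exact RealLE.mono hs hrs.le

lemma InUnit.st_le_add {ε : ℝ} {x y : S.Hyper} (hx : InUnit x) (hy : InUnit y)
    (h : S.LEAdd ε x y) : S.st x ≤ S.st y + ε := by
  refine csSup_le ⟨0, hx.zero_le⟩ fun r hr => ?_
  have := hy.le_st (RealLE.of_leAdd hr h)
  linarith

/-! ### Internal probability spaces -/

lemma measure_map_map (F : W → ProbSpaceIn X) (g : W → Set X) (z : S.star W) :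
    S.measure (S.map F z) (S.map g z) = S.map (fun w => ULift.up ((F w).measure (g w))) z := by
  rw [measure, ← map_prodMk, map_map]

lemma mem_algebra_map (F : W → ProbSpaceIn X) (g : W → Set X) (z : S.star W) :
    S.Mem (S.map g z) (S.algebra (S.map F z)) ↔ z ∈ S.ext {w | g w ∈ (F w).algebra} := by
  rw [algebra, map_map, mem_map_map]

lemma leAdd_measure_map (ε : ℝ) (F F' : W → ProbSpaceIn X) (g g' : W → Set X) (z : S.star W) :
    S.LEAdd ε (S.measure (S.map F z) (S.map g z)) (S.measure (S.map F' z) (S.map g' z)) ↔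
      z ∈ S.ext {w | (F w).measure (g w) ≤ (F' w).measure (g' w) + ε} := by
  rw [LEAdd, measure_map_map, measure_map_map, ← map_prodMk]
  exact S.mem_ext_map _ (fun p : ULift.{u} ℝ × ULift.{u} ℝ => p.1.down ≤ p.2.down + ε) z

variable {M N Q : S.InternalProbSpace X} {A B C : S.star (Set X)}

lemma inUnit_measure (hA : S.Mem A (S.algebra M)) : InUnit (S.measure M A) := by
  have hA' : S.pair M A ∈ S.ext {p : ProbSpaceIn X × Set X | p.2 ∈ p.1.algebra} := by
    rw [← mem_algebra_map, S.map_fst_pair, S.map_snd_pair]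
    exact hA
  refine (S.mem_ext_map _ _ _).2 (S.ext_mono ?_ hA')
  exact fun p hp => ⟨p.1.measure_nonneg _ hp, p.1.measure_le_one hp⟩

lemma measure_mono (hA : S.Mem A (S.algebra M)) (hC : S.Mem C (S.algebra M))
    (hAC : S.toSet A ⊆ S.toSet C) : S.LEAdd 0 (S.measure M A) (S.measure M C) := by
  set z := S.pair (S.pair M A) C
  have eM : M = S.map (fun w : (ProbSpaceIn X × Set X) × Set X => w.1.1) z := by
    rw [← S.map_map Prod.fst Prod.fst, S.map_fst_pair, S.map_fst_pair]
  have eA : A = S.map (fun w : (ProbSpaceIn X × Set X) × Set X => w.1.2) z := by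
    rw [← S.map_map Prod.snd Prod.fst, S.map_fst_pair, S.map_snd_pair]
  have eC : C = S.map (fun w : (ProbSpaceIn X × Set X) × Set X => w.2) z :=
    (S.map_snd_pair _ _).symm
  rw [eM, eA, mem_algebra_map] at hA
  rw [eM, eC, mem_algebra_map] at hC
  rw [eA, eC, toSet_map_subset] at hAC
  rw [eM, eA, eC, leAdd_measure_map]
  refine S.ext_mono ?_ ((S.mem_ext_and _).2 ⟨hA, (S.mem_ext_and _).2 ⟨hC, hAC⟩⟩)
  rintro w ⟨h1, h2, h3⟩
  simpa using w.1.1.measure_mono h1 h2 h3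

lemma st_measure_mono (hA : S.Mem A (S.algebra M)) (hC : S.Mem C (S.algebra M))
    (hAC : S.toSet A ⊆ S.toSet C) : S.st (S.measure M A) ≤ S.st (S.measure M C) := by
  simpa using (inUnit_measure hA).st_le_add (inUnit_measure hC) (measure_mono hA hC hAC)

lemma toSet_subset_carrier (hA : S.Mem A (S.algebra M)) :
    S.toSet A ⊆ S.toSet (S.carrier M) := by
  have hA' : S.pair M A ∈ S.ext {p : ProbSpaceIn X × Set X | p.2 ∈ p.1.algebra} := by
    rw [← mem_algebra_map, S.map_fst_pair, S.map_snd_pair]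
    exact hA
  have h := (S.toSet_map_subset (fun p : ProbSpaceIn X × Set X => p.2)
    (fun p => p.1.carrier) _).2 (S.ext_mono (fun p hp => p.1.isAlgebraOn.subset _ hp) hA')
  rwa [S.map_snd_pair, ← S.map_map ProbSpaceIn.carrier Prod.fst, S.map_fst_pair] at h

lemma carrier_mem_algebra (M : S.InternalProbSpace X) : S.Mem (S.carrier M) (S.algebra M) :=
  (S.mem_map_map ProbSpaceIn.carrier ProbSpaceIn.algebra M).2
    (S.mem_ext_of_forall (fun p => p.isAlgebraOn.carrier_mem) M)

lemma exists_empty_mem_algebra (M : S.InternalProbSpace X) :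
    ∃ A, S.Mem A (S.algebra M) ∧ S.toSet A = ∅ := by
  refine ⟨S.map (fun _ => ∅) M, (S.mem_map_map _ ProbSpaceIn.algebra M).2
    (S.mem_ext_of_forall (fun p => p.isAlgebraOn.empty_mem) M), ?_⟩
  refine Set.eq_empty_of_forall_notMem fun x hx => ?_
  have h : S.pair M x ∈ S.ext {p : ProbSpaceIn X × X | p.2 ∈ (∅ : Set X)} := by
    rw [← mem_map_map, S.map_snd_pair, ← S.map_map (fun _ => ∅) Prod.fst, S.map_fst_pair]
    exact hx
  exact (S.mem_ext_not _).1
    (S.mem_ext_of_forall (R := fun p : ProbSpaceIn X × X => ¬ p.2 ∈ (∅ : Set X)) (by simp) _) h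

/-- Transfer of `ProbSpaceIn.Approximates`. -/
lemma mem_ext_approximates (ε : ℝ) (F : W → ProbSpaceIn X) (g : W → Set (Set X))
    (z : S.star W) :
    z ∈ S.ext {w | (F w).Approximates ε (g w)} ↔
      ∀ G, S.Mem G (S.map g z) → ∃ A, ∃ C, S.Mem A (S.algebra (S.map F z)) ∧
        S.Mem C (S.algebra (S.map F z)) ∧ S.toSet A ⊆ S.toSet G ∧ S.toSet G ⊆ S.toSet C ∧
          S.LEAdd ε (S.measure (S.map F z) C) (S.measure (S.map F z) A) := by
  simp only [ProbSpaceIn.Approximates]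
  rw [mem_ext_forall]
  refine forall_congr' fun G => ?_
  rw [mem_ext_imp, ← mem_map_map, S.map_snd_pair, ← S.map_map g Prod.fst, S.map_fst_pair,
    mem_ext_exists]
  refine imp_congr_right fun _ => exists_congr fun A => ?_
  rw [mem_ext_exists]
  refine exists_congr fun C => ?_
  simp only [mem_ext_and]
  rw [← leAdd_measure_map, ← mem_algebra_map, ← mem_algebra_map, ← toSet_map_subset,
    ← toSet_map_subset]
  set t := S.pair (S.pair (S.pair z G) A) C
  have eF : S.map (fun p : ((W × Set X) × Set X) × Set X => F p.1.1.1) t = S.map F z := by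
    rw [← S.map_map (fun p : (W × Set X) × Set X => F p.1.1) Prod.fst, S.map_fst_pair,
      ← S.map_map (fun p : W × Set X => F p.1) Prod.fst, S.map_fst_pair,
      ← S.map_map F Prod.fst, S.map_fst_pair]
  have eG : S.map (fun p : ((W × Set X) × Set X) × Set X => p.1.1.2) t = G := by
    rw [← S.map_map (fun p : (W × Set X) × Set X => p.1.2) Prod.fst, S.map_fst_pair,
      ← S.map_map Prod.snd Prod.fst, S.map_fst_pair, S.map_snd_pair]
  have eA : S.map (fun p : ((W × Set X) × Set X) × Set X => p.1.2) t = A := by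
    rw [← S.map_map Prod.snd Prod.fst, S.map_fst_pair, S.map_snd_pair]
  have eC : S.map (fun p : ((W × Set X) × Set X) × Set X => p.2) t = C := S.map_snd_pair _ _
  rw [eF, eG, eA, eC]

/-! ### Loeb measures -/

lemma le_loebInner {B : Set (S.star X)} (hA : S.Mem A (S.algebra M)) (hAB : S.toSet A ⊆ B) :
    S.st (S.measure M A) ≤ S.loebInner M B := by
  refine le_csSup ⟨1, ?_⟩ ⟨A, hA, hAB, rfl⟩
  rintro _ ⟨A', hA', -, rfl⟩
  exact (inUnit_measure hA').st_le_one

lemma loebOuter_le {B : Set (S.star X)} (hC : S.Mem C (S.algebra M)) (hBC : B ⊆ S.toSet C) :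
    S.loebOuter M B ≤ S.st (S.measure M C) := by
  refine csInf_le ⟨0, ?_⟩ ⟨C, hC, hBC, rfl⟩
  rintro _ ⟨C', hC', -, rfl⟩
  exact (inUnit_measure hC').st_nonneg

lemma loebInner_le {B : Set (S.star X)} {r : ℝ}
    (h : ∀ A, S.Mem A (S.algebra M) → S.toSet A ⊆ B → S.st (S.measure M A) ≤ r) :
    S.loebInner M B ≤ r := by
  obtain ⟨E, hE, hE'⟩ := exists_empty_mem_algebra M
  refine csSup_le ⟨_, E, hE, by simp [hE'], rfl⟩ ?_
  rintro _ ⟨A, hA, hAB, rfl⟩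
  exact h A hA hAB

lemma le_loebOuter {B : Set (S.star X)} (hB : B ⊆ S.toSet (S.carrier M)) {r : ℝ}
    (h : ∀ C, S.Mem C (S.algebra M) → B ⊆ S.toSet C → r ≤ S.st (S.measure M C)) :
    r ≤ S.loebOuter M B := by
  refine le_csInf ⟨_, S.carrier M, carrier_mem_algebra M, hB, rfl⟩ ?_
  rintro _ ⟨C, hC, hBC, rfl⟩
  exact h C hC hBC

lemma toSet_mem_loebAlgebra (hA : S.Mem A (S.algebra M)) : S.toSet A ∈ S.loebAlgebra M := by
  refine ⟨toSet_subset_carrier hA, le_antisymm ?_ ?_⟩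
  · exact loebInner_le fun A' hA' hsub => le_loebOuter (toSet_subset_carrier hA)
      fun C hC hsub' => st_measure_mono hA' hC (hsub.trans hsub')
  · exact (loebOuter_le hA subset_rfl).trans (le_loebInner hA subset_rfl)

lemma exists_approx_of_mem_loebAlgebra {B : Set (S.star X)} (hB : B ∈ S.loebAlgebra M) {ε : ℝ}
    (hε : 0 < ε) :
    ∃ A, ∃ C, S.Mem A (S.algebra M) ∧ S.Mem C (S.algebra M) ∧ S.toSet A ⊆ B ∧
      B ⊆ S.toSet C ∧ S.LEAdd ε (S.measure M C) (S.measure M A) := by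
  obtain ⟨E, hE, hE'⟩ := exists_empty_mem_algebra M
  obtain ⟨_, ⟨A, hA, hAB, rfl⟩, hlt⟩ := exists_lt_of_lt_csSup
    (s := {r : ℝ | ∃ A, S.Mem A (S.algebra M) ∧ S.toSet A ⊆ B ∧ r = S.st (S.measure M A)})
    ⟨_, E, hE, by simp [hE'], rfl⟩ (sub_lt_self (S.loebInner M B) (half_pos hε))
  obtain ⟨_, ⟨C, hC, hBC, rfl⟩, hlt'⟩ := exists_lt_of_csInf_lt
    (s := {r : ℝ | ∃ C, S.Mem C (S.algebra M) ∧ B ⊆ S.toSet C ∧ r = S.st (S.measure M C)})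
    ⟨_, S.carrier M, carrier_mem_algebra M, hB.1, rfl⟩
    (lt_add_of_pos_right (S.loebOuter M B) (half_pos hε))
  refine ⟨A, C, hA, hC, hAB, hBC, ?_⟩
  refine leAdd_of_realLE (r := S.loebInner M B - ε / 2) (s := S.loebOuter M B + ε / 2)
    (by rw [hB.2]; linarith) ?_ ((inUnit_measure hA).realLE_of_lt_st hlt)
  exact fun h => absurd ((inUnit_measure hC).le_st h) (not_le.2 hlt')

/-- If the algebra and the measure of `Q` extend those of `M`, and every set of `Q` is approximated
by sets of `M` up to each standard `ε > 0`, then both spaces give each subset of their common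
carrier the same inner and the same outer Loeb measure. -/
lemma loebEquivalent_of_approx (hcar : S.carrier M = S.carrier Q)
    (hext : ∀ A, S.Mem A (S.algebra M) →
      S.Mem A (S.algebra Q) ∧ S.measure Q A = S.measure M A)
    (happ : ∀ ε : ℝ, 0 < ε → ∀ H, S.Mem H (S.algebra Q) → ∃ A, ∃ C, S.Mem A (S.algebra M) ∧
      S.Mem C (S.algebra M) ∧ S.toSet A ⊆ S.toSet H ∧ S.toSet H ⊆ S.toSet C ∧
        S.LEAdd ε (S.measure M C) (S.measure M A)) :
    S.LoebEquivalent M Q := by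
  have hst : ∀ ε : ℝ, 0 < ε → ∀ H, S.Mem H (S.algebra Q) → ∃ A, ∃ C, S.Mem A (S.algebra M) ∧
      S.Mem C (S.algebra M) ∧ S.toSet A ⊆ S.toSet H ∧ S.toSet H ⊆ S.toSet C ∧
        S.st (S.measure Q H) ≤ S.st (S.measure M A) + ε ∧
        S.st (S.measure M C) ≤ S.st (S.measure Q H) + ε := by
    intro ε hε H hH
    obtain ⟨A, C, hA, hC, hAH, hHC, hle⟩ := happ ε hε H hH
    refine ⟨A, C, hA, hC, hAH, hHC, ?_⟩
    have h := (inUnit_measure hC).st_le_add (inUnit_measure hA) hle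
    have h1 := st_measure_mono (hext A hA).1 hH hAH
    have h2 := st_measure_mono hH (hext C hC).1 hHC
    rw [(hext A hA).2] at h1
    rw [(hext C hC).2] at h2
    constructor <;> linarith
  have hinner : ∀ B, S.loebInner M B = S.loebInner Q B := by
    intro B
    refine le_antisymm (loebInner_le fun A hA hAB => ?_) (loebInner_le fun H hH hHB => ?_)
    · rw [← (hext A hA).2]
      exact le_loebInner (hext A hA).1 hAB
    · refine le_of_forall_pos_le_add fun ε hε => ?_
      obtain ⟨A, -, hA, -, hAH, -, hle, -⟩ := hst ε hε H hH
      have := le_loebInner hA (hAH.trans hHB)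
      linarith
  have houter : ∀ B ⊆ S.toSet (S.carrier M), S.loebOuter M B = S.loebOuter Q B := by
    intro B hB
    refine le_antisymm (le_loebOuter (hcar ▸ hB) fun H hH hBH => ?_)
      (le_loebOuter hB fun C hC hBC => ?_)
    · refine le_of_forall_pos_le_add fun ε hε => ?_
      obtain ⟨-, C, -, hC, -, hHC, -, hle⟩ := hst ε hε H hH
      have := loebOuter_le hC (hBH.trans hHC)
      linarith
    · rw [← (hext C hC).2]
      exact loebOuter_le (hext C hC).1 hBC
  refine ⟨hcar, ?_, fun B _ => hinner B⟩
  ext B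
  refine ⟨fun h => ⟨hcar ▸ h.1, ?_⟩, fun h => ⟨hcar.symm ▸ h.1, ?_⟩⟩
  · rw [← hinner, ← houter B h.1]
    exact h.2
  · rw [hinner, houter B (hcar.symm ▸ h.1)]
    exact h.2

end NonstandardExtension

/-! ### Extending the measure to the join -/

/-- Both algebras are finite, and they live on the same set. -/
def FiniteOnSameCarrier {X : Type u} (p : ProbSpaceIn X × ProbSpaceIn X) : Prop :=
  p.1.carrier = p.2.carrier ∧ p.1.algebra.Finite ∧ p.2.algebra.Finite

lemma FiniteOnSameCarrier.exists_join {X : Type u} {p : ProbSpaceIn X × ProbSpaceIn X}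
    (hp : FiniteOnSameCarrier p) :
    ∃ q : ProbSpaceIn X, q.carrier = p.1.carrier ∧
      q.algebra = generatedAlgebra p.1.carrier (p.1.algebra ∪ p.2.algebra) ∧
      ∀ A ∈ p.1.algebra, q.measure A = p.1.measure A := by
  refine p.1.exists_extension hp.2.1 (isAlgebraOn_generatedAlgebra ?_)
  rintro C (hC | hC)
  · exact p.1.isAlgebraOn.subset C hC
  · exact hp.1 ▸ p.2.isAlgebraOn.subset C hC

open Classical in
/-- A probability space on the algebra generated by both algebras whose measure extends the first
one. It is a standard function of the pair, so it acts on pairs of internal spaces; for pairs to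
which `FiniteOnSameCarrier` does not apply, the value is the first space. -/
noncomputable def joinSpace {X : Type u} (p : ProbSpaceIn X × ProbSpaceIn X) : ProbSpaceIn X :=
  if hp : FiniteOnSameCarrier p then hp.exists_join.choose else p.1

lemma FiniteOnSameCarrier.joinSpace_spec {X : Type u} {p : ProbSpaceIn X × ProbSpaceIn X}
    (hp : FiniteOnSameCarrier p) :
    (joinSpace p).carrier = p.1.carrier ∧
      (joinSpace p).algebra = generatedAlgebra p.1.carrier (p.1.algebra ∪ p.2.algebra) ∧
      ∀ A ∈ p.1.algebra, (joinSpace p).measure A = p.1.measure A := by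
  rw [joinSpace, dif_pos hp]
  exact hp.exists_join.choose_spec

lemma FiniteOnSameCarrier.finite_joinSpace {X : Type u} {p : ProbSpaceIn X × ProbSpaceIn X}
    (hp : FiniteOnSameCarrier p) : (joinSpace p).algebra.Finite := by
  rw [hp.joinSpace_spec.2.1]
  refine generatedAlgebra_finite ?_ (hp.2.1.union hp.2.2)
  rintro C (hC | hC)
  · exact p.1.isAlgebraOn.subset C hC
  · exact hp.1 ▸ p.2.isAlgebraOn.subset C hC

lemma FiniteOnSameCarrier.approximates_joinSpace {X : Type u}
    {p : ProbSpaceIn X × ProbSpaceIn X} (hp : FiniteOnSameCarrier p) {ε : ℝ}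
    (h : p.1.Approximates ε p.2.algebra) : p.1.Approximates (2 * ε) (joinSpace p).algebra := by
  rw [hp.joinSpace_spec.2.1]
  exact p.1.approximates_generatedAlgebra hp.2.1 (hp.1 ▸ p.2.isAlgebraOn) hp.2.2 h

theorem theorem2p4 (S : NonstandardExtension.{u, v}) {X : Type u}
    (M N : S.InternalProbSpace X) (hM : S.IsHyperfinite M) (hN : S.IsHyperfinite N)
    (hMN : S.LoebEquivalent M N) :
    ∃ Q : S.InternalProbSpace X,
      S.carrier Q = S.carrier M ∧ S.algebra Q = S.joinAlgebra M N ∧ S.IsHyperfinite Q ∧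
        S.LoebEquivalent M Q := by
  set p := S.pair M N
  have e1 : S.map Prod.fst p = M := S.map_fst_pair M N
  have e2 : S.map Prod.snd p = N := S.map_snd_pair M N
  have hfin : p ∈ S.ext {p | FiniteOnSameCarrier p} := by
    refine (S.mem_ext_and _).2 ⟨?_, (S.mem_ext_and _).2 ⟨?_, ?_⟩⟩
    · rw [← S.map_eq_map_iff, ← S.map_map ProbSpaceIn.carrier Prod.fst,
        ← S.map_map ProbSpaceIn.carrier Prod.snd, e1, e2]
      exact hMN.1
    · refine (S.mem_ext_map (fun q => q.1.algebra) Set.Finite p).1 ?_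
      rw [← S.map_map ProbSpaceIn.algebra, e1]
      exact hM
    · refine (S.mem_ext_map (fun q => q.2.algebra) Set.Finite p).1 ?_
      rw [← S.map_map ProbSpaceIn.algebra, e2]
      exact hN
  have hcar : S.carrier (S.map joinSpace p) = S.carrier M := by
    rw [← e1, NonstandardExtension.carrier, NonstandardExtension.carrier, S.map_map, S.map_map,
      S.map_eq_map_iff]
    exact S.ext_mono (fun q hq => (FiniteOnSameCarrier.joinSpace_spec hq).1) hfin
  refine ⟨S.map joinSpace p, hcar, ?_, ?_, ?_⟩
  · rw [NonstandardExtension.algebra, NonstandardExtension.joinAlgebra, S.map_map,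
      S.map_eq_map_iff]
    exact S.ext_mono (fun q hq => (FiniteOnSameCarrier.joinSpace_spec hq).2.1) hfin
  · exact (S.mem_ext_map _ _ _).2 ((S.mem_ext_map _ _ _).2
      (S.ext_mono (fun q hq => FiniteOnSameCarrier.finite_joinSpace hq) hfin))
  · refine NonstandardExtension.loebEquivalent_of_approx hcar.symm ?_ ?_
    · intro A hA
      have eA : S.map Prod.snd (S.pair p A) = A := S.map_snd_pair p A
      have ep : S.map Prod.fst (S.pair p A) = p := S.map_fst_pair p A
      have eM : S.map (fun w : (ProbSpaceIn X × ProbSpaceIn X) × Set X => w.1.1) (S.pair p A) =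
          M := by
        rw [← S.map_map Prod.fst Prod.fst, ep, e1]
      have eQ : S.map (fun w : (ProbSpaceIn X × ProbSpaceIn X) × Set X => joinSpace w.1)
          (S.pair p A) = S.map joinSpace p := by
        rw [← S.map_map joinSpace Prod.fst, ep]
      have hA' := (NonstandardExtension.mem_algebra_map
        (fun w : (ProbSpaceIn X × ProbSpaceIn X) × Set X => w.1.1) Prod.snd (S.pair p A)).1
        (by rw [eM, eA]; exact hA)
      have h := (S.mem_ext_and _).2
        ⟨(NonstandardExtension.pair_mem_ext_fst (y := A)).2 hfin, hA'⟩
      constructor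
      · have := (NonstandardExtension.mem_algebra_map
          (fun w : (ProbSpaceIn X × ProbSpaceIn X) × Set X => joinSpace w.1) Prod.snd
          (S.pair p A)).2 (S.ext_mono (fun w hw => by
            show w.2 ∈ (joinSpace w.1).algebra
            rw [(FiniteOnSameCarrier.joinSpace_spec hw.1).2.1]
            exact subset_generatedAlgebra (Or.inl hw.2)) h)
        rwa [eQ, eA] at this
      · have := (S.map_eq_map_iff
          (fun w : (ProbSpaceIn X × ProbSpaceIn X) × Set X =>
            ULift.up ((joinSpace w.1).measure w.2))
          (fun w => ULift.up (w.1.1.measure w.2)) (S.pair p A)).2 (S.ext_mono (fun w hw =>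
            congrArg ULift.up ((FiniteOnSameCarrier.joinSpace_spec hw.1).2.2 w.2 hw.2)) h)
        rwa [← NonstandardExtension.measure_map_map, ← NonstandardExtension.measure_map_map,
          eQ, eM, eA] at this
    · intro ε hε
      have happ : p ∈ S.ext {p | p.1.Approximates (ε / 2) p.2.algebra} := by
        rw [NonstandardExtension.mem_ext_approximates, e1,
          ← S.map_map ProbSpaceIn.algebra Prod.snd, e2]
        intro G hG
        refine NonstandardExtension.exists_approx_of_mem_loebAlgebra ?_ (half_pos hε)
        rw [hMN.2.1]
        exact NonstandardExtension.toSet_mem_loebAlgebra hG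
      have h : p ∈ S.ext {p | p.1.Approximates ε (joinSpace p).algebra} := by
        refine S.ext_mono ?_ ((S.mem_ext_and _).2 ⟨hfin, happ⟩)
        rintro q ⟨hq, hq'⟩
        have := FiniteOnSameCarrier.approximates_joinSpace hq hq'
        rwa [mul_div_cancel₀ ε two_ne_zero] at this
      rw [NonstandardExtension.mem_ext_approximates, e1,
        ← S.map_map ProbSpaceIn.algebra joinSpace] at h
      exact h
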